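/- Let $\alpha,\beta,\mu\in\mathbb{R}\setminus\{0\}$ satisfy $\Delta:=\alpha^2+\beta^2-2\mu^2>0$, and let $x_1,x_2\in\mathbb{R}$. Put $\delta:=\alpha^2-3\beta^2$, $\gamma:=3\alpha^2-\beta^2$, $y_1:=x+\delta t+x_1$, $y_2:=x+\gamma t+x_2$, $$G(t,x):=\frac{\beta\sqrt{\alpha^2+\beta^2}}{\alpha\sqrt{\Delta}}\sin(\alpha y_1)-\frac{\sqrt2\,\mu\beta\,[\cosh(\beta y_2)+\sinh(\beta y_2)]}{\Delta},$$ $$F(t,x):=\cosh(\beta y_2)-\frac{\sqrt2\,\mu\beta\,[\alpha\cos(\alpha y_1)-\beta\sin(\alpha y_1)]}{\alpha\sqrt{\alpha^2+\beta^2}\,\sqrt{\Delta}},$$ $g(t,x):=G(t,x-3\mu^2t)$ and $f(t,x):=F(t,x-3\mu^2t)$. Let $$B(t,x):=\mu+2\sqrt2\,\partial_x\Big[\arctan\Big(\frac{g(t,x)}{f(t,x)}\Big)\Big]$$ be the real breather of the mKdV equation $u_t+(u_{xx}+u^3)_x=0$ with nonvanishing boundary value $\mu$ at $\pm\infty$,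 where the derivative is understood as $\partial_x\arctan(g/f)=\dfrac{f\,g_x-f_x\,g}{f^2+g^2}$, also at the zeros of $f$ (the functions $f$ and $g$ have no common zero). Then, for every fixed $t\in\mathbb{R}$, the function $x\mapsto B(t,x)$ is smooth on $\mathbb{R}$ and satisfies at every $x\in\mathbb{R}$ the nonlinear stationary equation $$\begin{aligned}J[B]:={}&B_{xxxx}-\big(2(\beta^2-\alpha^2)+5\mu^2\big)(B_{xx}+B^3)+\Big((\alpha^2+\beta^2)^2+6\mu^2\big(\beta^2-\alpha^2+\tfrac54\mu^2\big)\Big)B\\&+5BB_x^2+5B^2B_{xx}+\tfrac32B^5-4(\beta^2-\alpha^2+\mu^2)\mu^3-(\alpha^2+\beta^2)^2\mu=0.\end{aligned}$$ -/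

import Mathlib

open scoped ContDiff

noncomputable section

/-- The phase `y₁ = x + δ t + x₁`, with `δ = α² - 3 β²`. -/
def phaseOne (α β x₁ t x : ℝ) : ℝ := x + (α ^ 2 - 3 * β ^ 2) * t + x₁

/-- The phase `y₂ = x + γ t + x₂`, with `γ = 3 α² - β²`. -/
def phaseTwo (α β x₂ t x : ℝ) : ℝ := x + (3 * α ^ 2 - β ^ 2) * t + x₂

/-- `Δ = α² + β² - 2 μ²`. -/
def discr (α β μ : ℝ) : ℝ := α ^ 2 + β ^ 2 - 2 * μ ^ 2

/-- The function `G_{α,β,μ}(t, x; x₁, x₂)` of the Gardner breather. -/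
def gardnerG (α β μ x₁ x₂ t x : ℝ) : ℝ :=
  β * √(α ^ 2 + β ^ 2) / (α * √(discr α β μ)) * Real.sin (α * phaseOne α β x₁ t x)
    - √2 * μ * β * (Real.cosh (β * phaseTwo α β x₂ t x) + Real.sinh (β * phaseTwo α β x₂ t x))
        / discr α β μ

/-- The function `F_{α,β,μ}(t, x; x₁, x₂)` of the Gardner breather. -/
def gardnerF (α β μ x₁ x₂ t x : ℝ) : ℝ :=
  Real.cosh (β * phaseTwo α β x₂ t x)
    - √2 * μ * β *
        (α * Real.cos (α * phaseOne α β x₁ t x) - β * Real.sin (α * phaseOne α β x₁ t x))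
        / (α * √(α ^ 2 + β ^ 2) * √(discr α β μ))

/-- `g(t, x) = G(t, x - 3 μ² t)`. -/
def nvbcG (α β μ x₁ x₂ t x : ℝ) : ℝ := gardnerG α β μ x₁ x₂ t (x - 3 * μ ^ 2 * t)

/-- `f(t, x) = F(t, x - 3 μ² t)`. -/
def nvbcF (α β μ x₁ x₂ t x : ℝ) : ℝ := gardnerF α β μ x₁ x₂ t (x - 3 * μ ^ 2 * t)

/-- The `x`-derivative of `arctan (g / f)`, in the form `(f g' - f' g) / (f² + g²)`, which also makes
sense at the zeros of `f` (where `arctan (g / f)` jumps by `π` and its derivative extends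
continuously). See `arctanQuotientDeriv_eq`. -/
def arctanQuotientDeriv (g f : ℝ → ℝ) (x : ℝ) : ℝ :=
  (f x * deriv g x - deriv f x * g x) / (f x ^ 2 + g x ^ 2)

/-- The real mKdV breather with nonvanishing boundary value `μ`,
`B(t, x) = μ + 2 √2 ∂ₓ [arctan (g(t, x) / f(t, x))]`. -/
def nvbcBreather (α β μ x₁ x₂ t x : ℝ) : ℝ :=
  μ + 2 * √2 * arctanQuotientDeriv (nvbcG α β μ x₁ x₂ t) (nvbcF α β μ x₁ x₂ t) x

/-- The fourth-order nonlinear operator `J` of the stationary equation, acting on functions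
of `x`. -/
def stationaryJ (α β μ : ℝ) (u : ℝ → ℝ) (x : ℝ) : ℝ :=
  iteratedDeriv 4 u x
    - (2 * (β ^ 2 - α ^ 2) + 5 * μ ^ 2) * (iteratedDeriv 2 u x + u x ^ 3)
    + ((α ^ 2 + β ^ 2) ^ 2 + 6 * μ ^ 2 * (β ^ 2 - α ^ 2 + 5 / 4 * μ ^ 2)) * u x
    + 5 * u x * deriv u x ^ 2 + 5 * u x ^ 2 * iteratedDeriv 2 u x + 3 / 2 * u x ^ 5
    - 4 * (β ^ 2 - α ^ 2 + μ ^ 2) * μ ^ 3 - (α ^ 2 + β ^ 2) ^ 2 * μ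

/-- Wherever `f ≠ 0`, `arctanQuotientDeriv g f` is the derivative of `arctan (g / f)`. -/
theorem arctanQuotientDeriv_eq (g f : ℝ → ℝ) (x : ℝ) (hg : DifferentiableAt ℝ g x)
    (hf : DifferentiableAt ℝ f x) (h0 : f x ≠ 0) :
    deriv (fun y => Real.arctan (g y / f y)) x = arctanQuotientDeriv g f x := by
  have h := (hg.hasDerivAt.div hf.hasDerivAt h0).arctan
  have h2 := h.deriv
  simp only [Pi.div_apply] at h2
  rw [h2, arctanQuotientDeriv]
  have hp : 0 < f x ^ 2 + g x ^ 2 := by positivity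
  have hq : 0 < 1 + (g x / f x) ^ 2 := by positivity
  have e : f x ^ 2 + g x ^ 2 = f x ^ 2 * (1 + (g x / f x) ^ 2) := by field_simp
  rw [e]
  field_simp

theorem nvbcBreather_eq (α β μ x₁ x₂ t x : ℝ) (h0 : nvbcF α β μ x₁ x₂ t x ≠ 0) :
    nvbcBreather α β μ x₁ x₂ t x
      = μ + 2 * √2 *
          deriv (fun y => Real.arctan (nvbcG α β μ x₁ x₂ t y / nvbcF α β μ x₁ x₂ t y)) x := by
  rw [nvbcBreather, arctanQuotientDeriv_eq _ _ x _ _ h0]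
  · unfold nvbcG gardnerG phaseOne phaseTwo
    fun_prop
  · unfold nvbcF gardnerF phaseOne phaseTwo
    fun_prop

/-- `f` and `g` have no common zero, so the breather is defined by a non-degenerate quotient at
every point. -/
theorem nvbc_sq_add_sq_pos (α β μ x₁ x₂ t x : ℝ) (hα : α ≠ 0) (hβ : β ≠ 0)
    (hΔ : 0 < discr α β μ) :
    0 < nvbcF α β μ x₁ x₂ t x ^ 2 + nvbcG α β μ x₁ x₂ t x ^ 2 := by
  by_contra hcon
  have hf : nvbcF α β μ x₁ x₂ t x = 0 := by
    nlinarith [sq_nonneg (nvbcF α β μ x₁ x₂ t x), sq_nonneg (nvbcG α β μ x₁ x₂ t x)]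
  have hg : nvbcG α β μ x₁ x₂ t x = 0 := by
    nlinarith [sq_nonneg (nvbcF α β μ x₁ x₂ t x), sq_nonneg (nvbcG α β μ x₁ x₂ t x)]
  unfold nvbcF gardnerF at hf
  unfold nvbcG gardnerG at hg
  generalize phaseOne α β x₁ t (x - 3 * μ ^ 2 * t) = y at hf hg
  generalize phaseTwo α β x₂ t (x - 3 * μ ^ 2 * t) = z at hf hg
  have hsc := Real.sin_sq_add_cos_sq (α * y)
  have hch := Real.cosh_sq (β * z)
  have hcp := Real.cosh_pos (β * z)
  generalize Real.sin (α * y) = s at *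
  generalize Real.cos (α * y) = c at *
  generalize Real.cosh (β * z) = C at *
  generalize Real.sinh (β * z) = S at *
  have hρ2 : √(α ^ 2 + β ^ 2) ^ 2 = α ^ 2 + β ^ 2 := Real.sq_sqrt (by positivity)
  have hρ : 0 < √(α ^ 2 + β ^ 2) := Real.sqrt_pos.2 (by positivity)
  have hd2 : √(discr α β μ) ^ 2 = discr α β μ := Real.sq_sqrt hΔ.le
  have hd : 0 < √(discr α β μ) := Real.sqrt_pos.2 hΔ
  generalize √(α ^ 2 + β ^ 2) = ρ at *
  generalize √(discr α β μ) = d at *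
  rw [← hd2] at hg
  generalize √2 * μ = m at *
  have h1 : ρ * d * s = m * α * (C + S) := by
    apply mul_left_cancel₀ hβ
    field_simp at hg
    linear_combination hg
  have h2 : α * ρ * d * C = m * β * (α * c - β * s) := by
    field_simp at hf
    linear_combination hf
  -- `ρ² d² C + m² β² (C + S) = m β ρ d c`
  have h3 : ρ ^ 2 * d ^ 2 * C + m ^ 2 * β ^ 2 * (C + S) = m * β * ρ * d * c := by
    apply mul_left_cancel₀ hα
    linear_combination ρ * d * h2 - m * β ^ 2 * h1
  have h4 : (ρ ^ 2 * d ^ 2 * C + m ^ 2 * β ^ 2 * (C + S)) ^ 2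
      + m ^ 4 * α ^ 2 * β ^ 2 * (C + S) ^ 2 = m ^ 2 * β ^ 2 * ρ ^ 2 * d ^ 2 := by
    rw [h3]
    linear_combination m ^ 2 * β ^ 2 * ρ ^ 2 * d ^ 2 * hsc
      - m ^ 2 * β ^ 2 * (ρ * d * s + m * α * (C + S)) * h1
  have h5 : 2 * C * (C + S) = (C + S) ^ 2 + 1 := by linear_combination hch
  have h6 : 0 < (ρ ^ 2 * d ^ 2 * C) ^ 2 := by positivity
  have h7 : (ρ ^ 2 * d ^ 2 * C) ^ 2 + m ^ 2 * β ^ 2 * ρ ^ 2 * d ^ 2 * (C + S) ^ 2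
      + (m ^ 2 * β ^ 2 * (C + S)) ^ 2 + m ^ 4 * α ^ 2 * β ^ 2 * (C + S) ^ 2 = 0 := by
    linear_combination h4 - m ^ 2 * β ^ 2 * ρ ^ 2 * d ^ 2 * h5
  have : 0 ≤ m ^ 2 * β ^ 2 * ρ ^ 2 * d ^ 2 * (C + S) ^ 2
      + (m ^ 2 * β ^ 2 * (C + S)) ^ 2 + m ^ 4 * α ^ 2 * β ^ 2 * (C + S) ^ 2 := by positivity
  linarith

end

/-!
Write `W = f + i g`. Then `B = μ + 2 √2 (arg W)'`, and the stationary equation is the quotient by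
`|W|²` of an equation bilinear in `W` and its conjugate.

Let `D^k` be Hirota's bilinear derivatives and let `u = μ + 2 √2 (arg W)'`. If
`D² (f·f + g·g) = 2 √2 μ D (g·f)`, equivalently `u² = μ² + 2 (log |W|²)''`, then the nonlinear terms
of `J[u]` are exactly those produced by the exponential (Bell polynomial) expansion of
`D^k W·W̄ / |W|²` in `log W` and its conjugate, and
`|W|² J[u] = 2 √2 (D⁵ + c D³ + (α² + β²)² D) (g·f) + 5 μ D⁴ (f·f + g·g)`,
`c = -(2 (β² - α²) + 5 μ²)`. This is `stationaryJ_eq_zero_of_bilinear`. It is proved in the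
coordinates `W⁽ᵏ⁾ / W`, in which differentiation acts polynomially: `(W⁽ᵏ⁾ / W)' = W⁽ᵏ⁺¹⁾ / W -
(W⁽ᵏ⁾ / W) (W' / W)`.

For the breather, `f` and `g` are linear combinations of `cosh (β y₂)`, `sinh (β y₂)`, `cos (α y₁)`,
`sin (α y₁)`, so each bilinear equation is an identity between the coefficients of these functions
(`hirotaD_quadratic_breather` and `hirotaD_quintic_breather`), a consequence of four polynomial
relations between those coefficients.
-/

/-! ### Hirota derivatives -/

/-- Hirota's bilinear derivative `D^k u·v = ∑ j, (-1)^j (k choose j) u⁽ᵏ⁻ʲ⁾ v⁽ʲ⁾` at a point, where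
`u` and `v` are the sequences of values of the successive derivatives of two functions there. -/
def hirotaD (k : ℕ) (u v : ℕ → ℝ) : ℝ :=
  ∑ j ∈ Finset.range (k + 1), (-1) ^ j * (k.choose j : ℝ) * u (k - j) * v j

theorem hirotaD_one (u v : ℕ → ℝ) : hirotaD 1 u v = u 1 * v 0 - u 0 * v 1 := by
  simp [hirotaD, Finset.sum_range_succ]; ring

theorem hirotaD_two (u v : ℕ → ℝ) : hirotaD 2 u v = u 2 * v 0 - 2 * u 1 * v 1 + u 0 * v 2 := by
  simp [hirotaD, Finset.sum_range_succ]; ring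

theorem hirotaD_three (u v : ℕ → ℝ) :
    hirotaD 3 u v = u 3 * v 0 - 3 * u 2 * v 1 + 3 * u 1 * v 2 - u 0 * v 3 := by
  simp [hirotaD, Finset.sum_range_succ, Nat.choose]; ring

theorem hirotaD_four (u v : ℕ → ℝ) :
    hirotaD 4 u v = u 4 * v 0 - 4 * u 3 * v 1 + 6 * u 2 * v 2 - 4 * u 1 * v 3 + u 0 * v 4 := by
  simp [hirotaD, Finset.sum_range_succ, Nat.choose]; ring

theorem hirotaD_five (u v : ℕ → ℝ) :
    hirotaD 5 u v = u 5 * v 0 - 5 * u 4 * v 1 + 10 * u 3 * v 2 - 10 * u 2 * v 3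
      + 5 * u 1 * v 4 - u 0 * v 5 := by
  simp [hirotaD, Finset.sum_range_succ, Nat.choose]; ring

/-! ### Ratios of the derivatives of `f + i g` to `f + i g` -/

/-- The real part of `W⁽ᵏ⁾ / W` for `W = f 0 + i g 0`, where `f k` and `g k` stand for the `k`-th
derivatives of `f 0` and `g 0`. -/
noncomputable def logJetRe (f g : ℕ → ℝ → ℝ) (k : ℕ) (x : ℝ) : ℝ :=
  (f k x * f 0 x + g k x * g 0 x) / (f 0 x ^ 2 + g 0 x ^ 2)

/-- The imaginary part of `W⁽ᵏ⁾ / W` for `W = f 0 + i g 0`, where `f k` and `g k` stand for the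
`k`-th derivatives of `f 0` and `g 0`. -/
noncomputable def logJetIm (f g : ℕ → ℝ → ℝ) (k : ℕ) (x : ℝ) : ℝ :=
  (g k x * f 0 x - f k x * g 0 x) / (f 0 x ^ 2 + g 0 x ^ 2)

section
variable {f g : ℕ → ℝ → ℝ}

theorem hasDerivAt_logJetRe (hf : ∀ k x, HasDerivAt (f k) (f (k + 1) x) x)
    (hg : ∀ k x, HasDerivAt (g k) (g (k + 1) x) x) (h0 : ∀ x, f 0 x ^ 2 + g 0 x ^ 2 ≠ 0)
    (k : ℕ) (x : ℝ) :
    HasDerivAt (logJetRe f g k)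
      (logJetRe f g (k + 1) x - (logJetRe f g k x * logJetRe f g 1 x
        - logJetIm f g k x * logJetIm f g 1 x)) x := by
  have h := (((hf k x).mul (hf 0 x)).add ((hg k x).mul (hg 0 x))).div
    (((hf 0 x).pow 2).add ((hg 0 x).pow 2)) (h0 x)
  refine h.congr_deriv ?_
  have h0x := h0 x
  simp only [logJetRe, logJetIm, Pi.add_apply, Pi.mul_apply, Pi.pow_apply]
  field_simp
  ring

theorem hasDerivAt_logJetIm (hf : ∀ k x, HasDerivAt (f k) (f (k + 1) x) x)
    (hg : ∀ k x, HasDerivAt (g k) (g (k + 1) x) x) (h0 : ∀ x, f 0 x ^ 2 + g 0 x ^ 2 ≠ 0)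
    (k : ℕ) (x : ℝ) :
    HasDerivAt (logJetIm f g k)
      (logJetIm f g (k + 1) x - (logJetRe f g k x * logJetIm f g 1 x
        + logJetIm f g k x * logJetRe f g 1 x)) x := by
  have h := (((hg k x).mul (hf 0 x)).sub ((hf k x).mul (hg 0 x))).div
    (((hf 0 x).pow 2).add ((hg 0 x).pow 2)) (h0 x)
  refine h.congr_deriv ?_
  have h0x := h0 x
  simp only [logJetRe, logJetIm, Pi.add_apply, Pi.sub_apply, Pi.mul_apply, Pi.pow_apply]
  field_simp
  ring

theorem eq_of_hasDerivAt_of_eq {φ ψ φ' ψ' : ℝ → ℝ} (h : ∀ x, φ x = ψ x)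
    (hφ : ∀ x, HasDerivAt φ (φ' x) x) (hψ : ∀ x, HasDerivAt ψ (ψ' x) x) (x : ℝ) :
    φ' x = ψ' x := by
  obtain rfl : φ = ψ := funext h
  exact (hφ x).unique (hψ x)

/-- The stationary equation for `u = μ + 2 √2 (arg (f + i g))'` follows from two equations bilinear
in `f` and `g`. The quadratic one, with its first two derivatives, eliminates `Re (W⁽ᵏ⁾ / W)` for
`k = 2, 3, 4`; what remains of `J[u]` is the quintic one divided by `f² + g²`. -/
theorem stationaryJ_eq_zero_of_bilinear {α β μ : ℝ}
    (hf : ∀ k x, HasDerivAt (f k) (f (k + 1) x) x)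
    (hg : ∀ k x, HasDerivAt (g k) (g (k + 1) x) x) (h0 : ∀ x, f 0 x ^ 2 + g 0 x ^ 2 ≠ 0)
    (hquad : ∀ x, hirotaD 2 (f · x) (f · x) + hirotaD 2 (g · x) (g · x)
      = 2 * √2 * μ * hirotaD 1 (g · x) (f · x))
    (hquint : ∀ x, 2 * √2 * (hirotaD 5 (g · x) (f · x)
        - (2 * (β ^ 2 - α ^ 2) + 5 * μ ^ 2) * hirotaD 3 (g · x) (f · x)
        + (α ^ 2 + β ^ 2) ^ 2 * hirotaD 1 (g · x) (f · x))
      + 5 * μ * (hirotaD 4 (f · x) (f · x) + hirotaD 4 (g · x) (g · x)) = 0) (x : ℝ) :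
    stationaryJ α β μ (fun y => μ + 2 * √2 * logJetIm f g 1 y) x = 0 := by
  have da := hasDerivAt_logJetRe hf hg h0
  have db := hasDerivAt_logJetIm hf hg h0
  -- The bilinear equations divided by `f² + g²`.
  have q : ∀ x, logJetRe f g 2 x = logJetRe f g 1 x ^ 2 + logJetIm f g 1 x ^ 2
      + √2 * μ * logJetIm f g 1 x := by
    intro x
    have h0x := h0 x
    have h := hquad x
    simp only [hirotaD_one, hirotaD_two] at h
    simp only [logJetRe, logJetIm]
    field_simp
    linear_combination (f 0 x ^ 2 + g 0 x ^ 2) / 2 * h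
  have p : ∀ x, 2 * √2 * (logJetIm f g 5 x - 5 * (logJetIm f g 4 x * logJetRe f g 1 x
          - logJetRe f g 4 x * logJetIm f g 1 x)
          + 10 * (logJetIm f g 3 x * logJetRe f g 2 x - logJetRe f g 3 x * logJetIm f g 2 x)
        - (2 * (β ^ 2 - α ^ 2) + 5 * μ ^ 2) * (logJetIm f g 3 x
          - 3 * (logJetIm f g 2 x * logJetRe f g 1 x - logJetRe f g 2 x * logJetIm f g 1 x))
        + (α ^ 2 + β ^ 2) ^ 2 * logJetIm f g 1 x)
      + 5 * μ * (2 * logJetRe f g 4 x - 8 * (logJetRe f g 3 x * logJetRe f g 1 x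
          + logJetIm f g 3 x * logJetIm f g 1 x)
          + 6 * (logJetRe f g 2 x ^ 2 + logJetIm f g 2 x ^ 2)) = 0 := by
    intro x
    have h0x := h0 x
    have h := hquint x
    simp only [hirotaD_one, hirotaD_three, hirotaD_four, hirotaD_five] at h
    simp only [logJetRe, logJetIm]
    field_simp
    linear_combination (f 0 x ^ 2 + g 0 x ^ 2) * h
  generalize logJetRe f g = a at *
  generalize logJetIm f g = b at *
  -- The quadratic equation and its first two derivatives, solved for `a 2`, `a 3`, `a 4`.
  have da1 : ∀ x, HasDerivAt (a 1) (2 * b 1 x ^ 2 + √2 * μ * b 1 x) x := fun x =>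
    (da 1 x).congr_deriv (by linear_combination q x)
  have db1 : ∀ x, HasDerivAt (b 1) (b 2 x - 2 * a 1 x * b 1 x) x := fun x =>
    (db 1 x).congr_deriv (by ring)
  have q3 : ∀ x, a 3 x = a 1 x ^ 3 + a 1 x * b 1 x ^ 2 + b 1 x * b 2 x
      + √2 * μ * (a 1 x * b 1 x + b 2 x) := fun x => by
    have h := eq_of_hasDerivAt_of_eq q (da 2)
      (fun x => (((da1 x).pow 2).add ((db1 x).pow 2)).add ((db1 x).const_mul (√2 * μ))) x
    norm_num at h
    linear_combination h + a 1 x * q x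
  have q4 : ∀ x, a 4 x = a 3 x * a 1 x - b 3 x * b 1 x
      + (3 * a 1 x ^ 2 + b 1 x ^ 2 + √2 * μ * b 1 x) * (2 * b 1 x ^ 2 + √2 * μ * b 1 x)
      + (2 * a 1 x * b 1 x + b 2 x + √2 * μ * a 1 x) * (b 2 x - 2 * a 1 x * b 1 x)
      + (b 1 x + √2 * μ) * (b 3 x - (a 2 x * b 1 x + b 2 x * a 1 x)) := fun x => by
    have h := eq_of_hasDerivAt_of_eq q3 (da 3)
      (fun x => ((((da1 x).pow 3).add ((da1 x).mul ((db1 x).pow 2))).add ((db1 x).mul (db 2 x))).add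
        ((((da1 x).mul (db1 x)).add (db 2 x)).const_mul (√2 * μ))) x
    norm_num at h
    linear_combination h
  -- The derivatives of `b 1`, hence of `u`, up to order four.
  have d2 : ∀ x, HasDerivAt (fun x => b 2 x - 2 * a 1 x * b 1 x)
      (b 3 x - 3 * a 1 x * b 2 x + 3 * a 1 x ^ 2 * b 1 x - 5 * b 1 x ^ 3
        - 3 * (√2 * μ) * b 1 x ^ 2) x := fun x =>
    ((db 2 x).sub (((da1 x).const_mul 2).mul (db1 x))).congr_deriv (by
      linear_combination -b 1 x * q x)
  have d3 : ∀ x, HasDerivAt (fun x => b 3 x - 3 * a 1 x * b 2 x + 3 * a 1 x ^ 2 * b 1 x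
        - 5 * b 1 x ^ 3 - 3 * (√2 * μ) * b 1 x ^ 2)
      (b 4 x - 4 * a 1 x * b 3 x + 6 * a 1 x ^ 2 * b 2 x - 4 * a 1 x ^ 3 * b 1 x
        + 44 * a 1 x * b 1 x ^ 3 - 22 * b 1 x ^ 2 * b 2 x
        + √2 * μ * (20 * a 1 x * b 1 x ^ 2 - 10 * b 1 x * b 2 x)) x := fun x =>
    (((((db 3 x).sub (((da1 x).const_mul 3).mul (db 2 x))).add
      ((((da1 x).pow 2).const_mul 3).mul (db1 x))).sub (((db1 x).pow 3).const_mul 5)).sub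
      (((db1 x).pow 2).const_mul (3 * (√2 * μ)))).congr_deriv (by
        norm_num
        linear_combination -b 1 x * q3 x + 3 * a 1 x * b 1 x * q x)
  have d4 : ∀ x, HasDerivAt (fun x => b 4 x - 4 * a 1 x * b 3 x + 6 * a 1 x ^ 2 * b 2 x
        - 4 * a 1 x ^ 3 * b 1 x + 44 * a 1 x * b 1 x ^ 3 - 22 * b 1 x ^ 2 * b 2 x
        + √2 * μ * (20 * a 1 x * b 1 x ^ 2 - 10 * b 1 x * b 2 x)) _ x := fun x =>
    ((((((db 4 x).sub (((da1 x).const_mul 4).mul (db 3 x))).add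
      ((((da1 x).pow 2).const_mul 6).mul (db 2 x))).sub
      ((((da1 x).pow 3).const_mul 4).mul (db1 x))).add
      (((da1 x).const_mul 44).mul ((db1 x).pow 3))).sub
      ((((db1 x).pow 2).const_mul 22).mul (db 2 x))).add
      (((((da1 x).const_mul 20).mul ((db1 x).pow 2)).sub
        (((db1 x).const_mul 10).mul (db 2 x))).const_mul (√2 * μ))
  have u1 := funext fun x => (((db1 x).const_mul (2 * √2)).const_add μ).deriv
  have u2 := funext fun x => ((d2 x).const_mul (2 * √2)).deriv
  have u3 := funext fun x => ((d3 x).const_mul (2 * √2)).deriv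
  have u4 := fun x => ((d4 x).const_mul (2 * √2)).deriv
  have hp := p x
  simp only [stationaryJ, iteratedDeriv_succ, iteratedDeriv_zero, u1, u2, u3, u4]
  simp only [Pi.pow_apply, q4, q3, q] at hp ⊢
  have hsqrt : √2 ^ 2 = (2 : ℝ) := Real.sq_sqrt zero_le_two
  generalize √2 = r at *
  generalize a 1 x = a1 at *
  generalize b 1 x = b1 at *
  generalize b 2 x = b2 at *
  generalize b 3 x = b3 at *
  generalize b 4 x = b4 at *
  generalize b 5 x = b5 at *
  -- The goal and `hp` are the same equation modulo `r ^ 2 = 2`.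
  linear_combination hp + (r * (-280 * a1 * b1 ^ 2 * b2 + 280 * a1 ^ 2 * b1 ^ 3 + 40 * b1 * b2 ^ 2
    + 40 * b1 ^ 2 * b3 + (20 * μ ^ 2 - 16 * β ^ 2 + 16 * α ^ 2) * b1 ^ 3
    + (48 * r ^ 2 - 104) * b1 ^ 5)
    + 20 * μ * (-a1 * b1 * b2 + a1 ^ 2 * b1 ^ 2 - b1 * b3 + b1 ^ 4 + b2 ^ 2)) * hsqrt

end

/-! ### Trigonometric-hyperbolic waves -/

/-- The function `w₀ cosh (b x + φ) + w₁ sinh (b x + φ) + w₂ cos (a x + θ) + w₃ sin (a x + θ)`. -/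
noncomputable def wave (a b θ φ : ℝ) (w : Fin 4 → ℝ) (x : ℝ) : ℝ :=
  w 0 * Real.cosh (b * x + φ) + w 1 * Real.sinh (b * x + φ)
    + w 2 * Real.cos (a * x + θ) + w 3 * Real.sin (a * x + θ)

/-- The action of differentiation on the coefficients of a `wave`. -/
noncomputable def waveCoeff (a b : ℝ) (w : Fin 4 → ℝ) : Fin 4 → ℝ :=
  ![b * w 1, b * w 0, a * w 3, -(a * w 2)]

theorem hasDerivAt_wave (a b θ φ : ℝ) (w : Fin 4 → ℝ) (x : ℝ) :
    HasDerivAt (wave a b θ φ w) (wave a b θ φ (waveCoeff a b w) x) x := by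
  have ha : HasDerivAt (fun x => a * x + θ) a x := by
    simpa using ((hasDerivAt_id x).const_mul a).add_const θ
  have hb : HasDerivAt (fun x => b * x + φ) b x := by
    simpa using ((hasDerivAt_id x).const_mul b).add_const φ
  refine ((((hb.cosh.const_mul (w 0)).add (hb.sinh.const_mul (w 1))).add
    (ha.cos.const_mul (w 2))).add (ha.sin.const_mul (w 3))).congr_deriv ?_
  simp [wave, waveCoeff]
  ring

/-- The `k`-th derivative of a `wave`. -/
noncomputable def waveJet (a b θ φ : ℝ) (w : Fin 4 → ℝ) (k : ℕ) : ℝ → ℝ :=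
  wave a b θ φ ((waveCoeff a b)^[k] w)

theorem hasDerivAt_waveJet (a b θ φ : ℝ) (w : Fin 4 → ℝ) (k : ℕ) (x : ℝ) :
    HasDerivAt (waveJet a b θ φ w k) (waveJet a b θ φ w (k + 1) x) x := by
  unfold waveJet
  rw [Function.iterate_succ_apply']
  exact hasDerivAt_wave a b θ φ _ x

theorem contDiff_waveJet (a b θ φ : ℝ) (w : Fin 4 → ℝ) (k : ℕ) :
    ContDiff ℝ ∞ (waveJet a b θ φ w k) := by
  unfold waveJet wave
  fun_prop

/-! ### The bilinear equations of the breather -/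

section

variable {α β m κ k l : ℝ}

/-- The quadratic bilinear equation, with `m = √2 μ`. Modulo `cosh² - sinh² = 1` and
`cos² + sin² = 1`, its left and right sides are linear in `1` and in the products of a hyperbolic
and a trigonometric function, and `h₁`, ..., `h₄` match the coefficients. They hold for the
breather, where `κ`, `k` and `l` are the coefficients in `f` and `g`. -/
theorem hirotaD_quadratic_breather (θ φ : ℝ) (h₁ : κ * (α ^ 2 + β ^ 2) = m * k)
    (h₂ : β * l = α ^ 2 * k * κ) (h₃ : α ^ 2 * k * (k - m * κ) = β ^ 2)
    (h₄ : l * (k - m * κ) = κ * β) {f g : ℕ → ℝ → ℝ}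
    (hf : f = waveJet α β θ φ ![1, 0, -(κ * α), κ * β])
    (hg : g = waveJet α β θ φ ![-l, -l, 0, k]) (x : ℝ) :
    hirotaD 2 (f · x) (f · x) + hirotaD 2 (g · x) (g · x)
      = 2 * m * hirotaD 1 (g · x) (f · x) := by
  subst hf hg
  have hC := Real.cosh_sq (β * x + φ)
  have hs := Real.sin_sq_add_cos_sq (α * x + θ)
  simp only [hirotaD_one, hirotaD_two, waveJet, wave, waveCoeff,
    Function.iterate_succ_apply, Function.iterate_zero_apply, Matrix.cons_val]
  generalize Real.cosh (β * x + φ) = C at *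
  generalize Real.sinh (β * x + φ) = S at *
  generalize Real.cos (α * x + θ) = c at *
  generalize Real.sin (α * x + θ) = s at *
  grind

/-- The quintic bilinear equation, with `m = √2 μ`; it holds for the same reason as the quadratic
one. -/
theorem hirotaD_quintic_breather (θ φ : ℝ) (h₁ : κ * (α ^ 2 + β ^ 2) = m * k)
    (h₂ : β * l = α ^ 2 * k * κ) (h₃ : α ^ 2 * k * (k - m * κ) = β ^ 2)
    (h₄ : l * (k - m * κ) = κ * β) {f g : ℕ → ℝ → ℝ}
    (hf : f = waveJet α β θ φ ![1, 0, -(κ * α), κ * β])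
    (hg : g = waveJet α β θ φ ![-l, -l, 0, k]) (x : ℝ) :
    4 * (hirotaD 5 (g · x) (f · x)
        - (2 * (β ^ 2 - α ^ 2) + 5 / 2 * m ^ 2) * hirotaD 3 (g · x) (f · x)
        + (α ^ 2 + β ^ 2) ^ 2 * hirotaD 1 (g · x) (f · x))
      + 5 * m * (hirotaD 4 (f · x) (f · x) + hirotaD 4 (g · x) (g · x)) = 0 := by
  subst hf hg
  have hC := Real.cosh_sq (β * x + φ)
  have hs := Real.sin_sq_add_cos_sq (α * x + θ)
  simp only [hirotaD_one, hirotaD_three, hirotaD_four, hirotaD_five, waveJet, wave, waveCoeff,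
    Function.iterate_succ_apply, Function.iterate_zero_apply, Matrix.cons_val]
  generalize Real.cosh (β * x + φ) = C at *
  generalize Real.sinh (β * x + φ) = S at *
  generalize Real.cos (α * x + θ) = c at *
  generalize Real.sin (α * x + θ) = s at *
  grind

end

/-! ### The stationary equation -/

theorem proposition3p1 (α β μ x₁ x₂ : ℝ) (hα : α ≠ 0) (hβ : β ≠ 0) (hμ : μ ≠ 0)
    (hΔ : 0 < α ^ 2 + β ^ 2 - 2 * μ ^ 2) (t : ℝ) :
    ContDiff ℝ ∞ (fun x => nvbcBreather α β μ x₁ x₂ t x) ∧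
      ∀ x : ℝ, stationaryJ α β μ (fun y => nvbcBreather α β μ x₁ x₂ t y) x = 0 := by
  have hpos := nvbc_sq_add_sq_pos α β μ x₁ x₂ t
  have hρ2 : √(α ^ 2 + β ^ 2) ^ 2 = α ^ 2 + β ^ 2 := Real.sq_sqrt (by positivity)
  have hρ : √(α ^ 2 + β ^ 2) ≠ 0 := (Real.sqrt_pos.2 (by positivity)).ne'
  have hd2 : √(discr α β μ) ^ 2 = α ^ 2 + β ^ 2 - 2 * μ ^ 2 := Real.sq_sqrt hΔ.le
  have hd : √(discr α β μ) ≠ 0 := (Real.sqrt_pos.2 hΔ).ne'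
  have h2 : √2 ^ 2 = (2 : ℝ) := Real.sq_sqrt zero_le_two
  have hdiscr : discr α β μ = √(discr α β μ) ^ 2 := hd2.symm
  obtain ⟨θ, hθ⟩ : ∃ θ, ∀ x, α * phaseOne α β x₁ t (x - 3 * μ ^ 2 * t) = α * x + θ :=
    ⟨α * (-3 * μ ^ 2 * t + (α ^ 2 - 3 * β ^ 2) * t + x₁), fun x => by unfold phaseOne; ring⟩
  obtain ⟨φ, hφ⟩ : ∃ φ, ∀ x, β * phaseTwo α β x₂ t (x - 3 * μ ^ 2 * t) = β * x + φ :=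
    ⟨β * (-3 * μ ^ 2 * t + (3 * α ^ 2 - β ^ 2) * t + x₂), fun x => by unfold phaseTwo; ring⟩
  obtain ⟨κ, hκ⟩ : ∃ κ, κ = √2 * μ * β / (α * √(α ^ 2 + β ^ 2) * √(discr α β μ)) := ⟨_, rfl⟩
  obtain ⟨k, hk⟩ : ∃ k, k = β * √(α ^ 2 + β ^ 2) / (α * √(discr α β μ)) := ⟨_, rfl⟩
  obtain ⟨l, hl⟩ : ∃ l, l = √2 * μ * β / √(discr α β μ) ^ 2 := ⟨_, rfl⟩
  obtain ⟨f, hf⟩ : ∃ f, f = waveJet α β θ φ ![1, 0, -(κ * α), κ * β] := ⟨_, rfl⟩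
  obtain ⟨g, hg⟩ : ∃ g, g = waveJet α β θ φ ![-l, -l, 0, k] := ⟨_, rfl⟩
  have hF : nvbcF α β μ x₁ x₂ t = f 0 := by
    funext x
    simp only [hf, hκ, nvbcF, gardnerF, hθ, hφ, waveJet, wave, Function.iterate_zero_apply,
      Matrix.cons_val]
    ring
  have hG : nvbcG α β μ x₁ x₂ t = g 0 := by
    funext x
    simp only [hg, hk, hl, nvbcG, gardnerG, hθ, hφ, waveJet, wave, Function.iterate_zero_apply,
      Matrix.cons_val, ← hdiscr]
    ring
  have df : ∀ k x, HasDerivAt (f k) (f (k + 1) x) x := hf ▸ hasDerivAt_waveJet α β θ φ _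
  have dg : ∀ k x, HasDerivAt (g k) (g (k + 1) x) x := hg ▸ hasDerivAt_waveJet α β θ φ _
  have h0 : ∀ x, f 0 x ^ 2 + g 0 x ^ 2 ≠ 0 := fun x => by
    simpa only [hF, hG] using (hpos x hα hβ hΔ).ne'
  have hB : nvbcBreather α β μ x₁ x₂ t = fun x => μ + 2 * √2 * logJetIm f g 1 x := by
    funext x
    rw [nvbcBreather, arctanQuotientDeriv, hF, hG, (df 0 x).deriv, (dg 0 x).deriv, logJetIm,
      mul_comm (f 0 x)]
  have hm : (√2 * μ) ^ 2 = 2 * μ ^ 2 := by rw [mul_pow, h2]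
  have h₁ : κ * (α ^ 2 + β ^ 2) = √2 * μ * k := by
    rw [hκ, hk]
    field_simp
    rw [hρ2]
  have h₂ : β * l = α ^ 2 * k * κ := by
    rw [hκ, hk, hl]
    field_simp
  have hkκ : k - √2 * μ * κ = β * √(discr α β μ) / (α * √(α ^ 2 + β ^ 2)) := by
    rw [hκ, hk]
    field_simp
    rw [hρ2, h2, hd2]
  have h₃ : α ^ 2 * k * (k - √2 * μ * κ) = β ^ 2 := by
    rw [hkκ, hk]
    field_simp
  have h₄ : l * (k - √2 * μ * κ) = κ * β := by
    rw [hkκ, hκ, hl]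
    field_simp
  change ContDiff ℝ ∞ (nvbcBreather α β μ x₁ x₂ t) ∧
    ∀ x, stationaryJ α β μ (nvbcBreather α β μ x₁ x₂ t) x = 0
  rw [hB]
  constructor
  · have cf : ∀ k, ContDiff ℝ ∞ (f k) := hf ▸ contDiff_waveJet α β θ φ _
    have cg : ∀ k, ContDiff ℝ ∞ (g k) := hg ▸ contDiff_waveJet α β θ φ _
    exact contDiff_const.add (contDiff_const.mul
      ((((cg 1).mul (cf 0)).sub ((cf 1).mul (cg 0))).div (((cf 0).pow 2).add ((cg 0).pow 2)) h0))
  · refine stationaryJ_eq_zero_of_bilinear df dg h0 (fun x => ?_) (fun x => ?_)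
    · linear_combination hirotaD_quadratic_breather θ φ h₁ h₂ h₃ h₄ hf hg x
    · have h := hirotaD_quintic_breather θ φ h₁ h₂ h₃ h₄ hf hg x
      rw [hm] at h
      -- The two forms differ by the factor `√2 / 2`.
      linear_combination √2 / 2 * h
        - 5 / 2 * μ * (hirotaD 4 (f · x) (f · x) + hirotaD 4 (g · x) (g · x)) * h2
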